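/- Let $d\ge 1$ and let $\Omega\subset\mathbb{R}^d$ be an open, connected and bounded set with Lipschitz boundary. Let $\bar K\colon[0,+\infty)\to[0,+\infty)$ be a measurable function with $\int_0^{+\infty}\bar K(r)\,r^d\,\mathrm{d}r<+\infty$, put $K(h)=\bar K(|h|)$ for $h\in\mathbb{R}^d$, and suppose that $K$ is not zero almost everywhere. For $\varepsilon>0$ let $K_\varepsilon(h)=\varepsilon^{-d}K(h/\varepsilon)$ and, for a measurable set $E\subset\mathbb{R}^d$ with characteristic function $\chi_E$, let $$J^1_\varepsilon(E,\Omega)=\int_\Omega\int_\Omega K_\varepsilon(y-x)\,|\chi_E(y)-\chi_E(x)|\,\mathrm{d}y\,\mathrm{d}x .$$ A measurable set $E\subset\mathbb{R}^d$ has finite perimeter in $\Omega$ if $\chi_E\in L^1(\Omega)$ and the total variation of its distributional gradient on $\Omega$, $$|\mathrm{D}\chi_E|(\Omega)=\sup\Big\{\int_\Omega \chi_E\,\operatorname{div}\varphi\,\mathrm{d}x:\ \varphi\in C^1_c(\Omega;\mathbb{R}^d),\ |\varphi|\le 1\Big\},$$ is finite. Theorem (Compactness criterion). For every $n\in\mathbb{N}$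 let $\varepsilon_n>0$ and let $E_n\subset\Omega$ be measurable. If $\varepsilon_n\to0$ and the quantities $\frac{1}{\varepsilon_n}J^1_{\varepsilon_n}(E_n,\Omega)$ are uniformly bounded in $n$, then there exist a subsequence $(E_{n_k})_k$ and a set $E$ with finite perimeter in $\Omega$ such that $E_{n_k}\to E$ in $L^1(\Omega)$, that is, $\|\chi_{E_{n_k}}-\chi_E\|_{L^1(\Omega)}\to0$. -/

import Mathlib

open MeasureTheory Set Filter Topology
open scoped NNReal ENNReal

namespace NonlocalPerimeter

/-- `ℝᵈ` with the Euclidean norm and Lebesgue measure. -/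
abbrev Space (d : ℕ) : Type := EuclideanSpace ℝ (Fin d)

/-- The characteristic function `χ_E` of a set. -/
noncomputable def charFn {d : ℕ} (E : Set (Space d)) : Space d → ℝ :=
  E.indicator fun _ => 1

/-- The boundary of `Ω` is Lipschitz: near each of its points, in the coordinates `z + t e` with
`e` a unit vector and `z ⟂ e`, the set `Ω` is the strict subgraph `{t < g z}` of a Lipschitz
function `g`. -/
def HasLipschitzBoundary {d : ℕ} (Ω : Set (Space d)) : Prop :=
  ∀ p ∈ frontier Ω, ∃ (e : Space d) (V : Set (Space d)) (g : (Submodule.span ℝ {e})ᗮ → ℝ)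
    (L : ℝ≥0), ‖e‖ = 1 ∧ IsOpen V ∧ p ∈ V ∧ LipschitzWith L g ∧
      ∀ (z : (Submodule.span ℝ {e})ᗮ) (t : ℝ), (z : Space d) + t • e ∈ V →
        ((z : Space d) + t • e ∈ Ω ↔ t < g z)

/-- The radial kernel `K(h) = K̄(|h|)` with profile `K̄`. -/
noncomputable def radialKernel (d : ℕ) (Kbar : ℝ → ℝ) : Space d → ℝ :=
  fun h => Kbar ‖h‖

/-- The mass preserving rescaling `K_ε(h) = ε⁻ᵈ K(h / ε)`. -/
noncomputable def rescale {d : ℕ} (K : Space d → ℝ) (ε : ℝ) : Space d → ℝ :=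
  fun h => 1 / ε ^ d * K (ε⁻¹ • h)

/-- `J¹_K(u, Ω) = ∫_Ω ∫_Ω K(y - x) |u(y) - u(x)| dy dx`, as an element of `[0, ∞]`. -/
noncomputable def localEnergy {d : ℕ} (K : Space d → ℝ) (u : Space d → ℝ)
    (Ω : Set (Space d)) : ℝ≥0∞ :=
  ∫⁻ x in Ω, ∫⁻ y in Ω, ENNReal.ofReal (K (y - x) * |u y - u x|)

/-- The divergence `∑ᵢ ∂ᵢ φᵢ` of a vector field on `ℝᵈ`. -/
noncomputable def divergence {d : ℕ} (φ : Space d → Space d) (x : Space d) : ℝ :=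
  ∑ i : Fin d, (fderiv ℝ φ x (EuclideanSpace.single i 1)) i

/-- The total variation `|Du|(Ω)` of the distributional gradient of `u` on the open set `Ω`:
the supremum of `∫_Ω u div φ` over the `C¹` vector fields `φ` with compact support in `Ω` and
`|φ| ≤ 1`. It may be infinite. -/
noncomputable def totalVariation {d : ℕ} (u : Space d → ℝ) (Ω : Set (Space d)) : ℝ≥0∞ :=
  ⨆ (φ : Space d → Space d) (_ : ContDiff ℝ 1 φ ∧ HasCompactSupport φ ∧ tsupport φ ⊆ Ω ∧
      ∀ x, ‖φ x‖ ≤ 1),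
    ENNReal.ofReal (∫ x in Ω, u x * divergence φ x)

/-- `u ∈ BV(Ω)`: `u ∈ L¹(Ω)` and `|Du|(Ω) < ∞`. -/
def IsBV {d : ℕ} (u : Space d → ℝ) (Ω : Set (Space d)) : Prop :=
  IntegrableOn u Ω volume ∧ totalVariation u Ω < ∞

/-- `E` is Lebesgue measurable and has finite perimeter in `Ω`: `χ_E ∈ BV(Ω)`. -/
def HasFinitePerimeter {d : ℕ} (E Ω : Set (Space d)) : Prop :=
  NullMeasurableSet E volume ∧ IsBV (charFn E) Ω

/-- `E n → E` in `L¹(Ω)`, sets being identified with their characteristic functions. -/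
def TendstoL1 {d : ℕ} (E : ℕ → Set (Space d)) (E₀ Ω : Set (Space d)) : Prop :=
  Tendsto (fun n => eLpNorm (charFn (E n) - charFn E₀) 1 (volume.restrict Ω)) atTop (𝓝 0)

end NonlocalPerimeter

namespace NonlocalPerimeter

/-! Everything is measured by the exit volume, which is subadditive in `h`. The kernel is at least
some `δ > 0` on a bounded symmetric set `A` of positive measure, so the energy bound controls the
average over `a ∈ A` of the volume crossing from `E` to `Ω \ E` under `ε • a`. The volume leaving
`Ω` itself is `O(ε)`, because a bounded Lipschitz domain loses at most `CΩ ‖h‖` under a translation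
by `h`.

A Steinhaus argument upgrades the average to a pointwise bound: each small `h` is a sum of two
elements of `A` in many ways, so subadditivity gives exit volume `O(ε)` for all shifts of length at
most `ε r`. Chaining such shifts yields the key estimate `exitVolume E h ≤ M (‖h‖ + ε)`
(`exists_forall_exitVolume_le`).

This estimate is a Kolmogorov–Riesz type equicontinuity down to scale `ε`. Weak `L²` compactness
makes averages over small balls converge along a subsequence, and the estimate bounds the distance
of the sets to their averages, so the subsequence is Cauchy in `L¹`. In the limit `exitVolume E₀ h ≤
M ‖h‖`, which bounds the difference quotients of `χ_E₀` tested against vector fields, hence the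
perimeter. -/

/-- The measure of the set of points of `E` that leave `E` when translated by `h`. -/
noncomputable def exitVolume {d : ℕ} (E : Set (Space d)) (h : Space d) : ℝ≥0∞ :=
  volume {x | x ∈ E ∧ x + h ∉ E}

/-! ### Exit volume of a bounded Lipschitz domain -/

theorem volume_preimage_add_right {d : ℕ} (A : Set (Space d)) (h : Space d) :
    volume {x | x + h ∈ A} = volume A :=
  measure_preimage_add_right volume h A

/-- The translates of the strip by `k δ e` are disjoint, since `G` grows at unit rate along `e`, and
about `1 / δ` of them fit in the ball of radius `ρ + 1`. -/
theorem volume_strip_le {d : ℕ} {G : Space d → ℝ} (hG : Measurable G) {e : Space d}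
    (he : ‖e‖ = 1) (hGe : ∀ x t, G (x + t • e) = G x + t) (p : Space d) (ρ : ℝ) {δ : ℝ}
    (hδ : 0 < δ) :
    volume {x | x ∈ Metric.ball p ρ ∧ -δ ≤ G x ∧ G x < 0} ≤
      ENNReal.ofReal (2 * δ) * volume (Metric.ball p (ρ + 1)) := by
  set A : Set (Space d) := {x | x ∈ Metric.ball p ρ ∧ -δ ≤ G x ∧ G x < 0} with hA
  set B := Metric.ball p (ρ + 1)
  have hAm : MeasurableSet A := by
    refine Metric.isOpen_ball.measurableSet.inter ?_
    exact (measurableSet_le measurable_const hG).inter (measurableSet_lt hG measurable_const)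
  have hAB : volume A ≤ volume B :=
    measure_mono fun x hx => Metric.ball_subset_ball (by linarith) hx.1
  rcases lt_or_ge 1 δ with h1 | h1
  · calc volume A ≤ 1 * volume B := by rwa [one_mul]
      _ ≤ _ := by
        gcongr
        rw [← ENNReal.ofReal_one]
        exact ENNReal.ofReal_le_ofReal (by linarith)
  set N := ⌊1 / δ⌋₊
  have hN1 : 1 ≤ N := Nat.le_floor (by rw [Nat.cast_one, le_div_iff₀ hδ]; linarith)
  have hN : (N : ℝ) * δ ≤ 1 := by
    rw [← le_div_iff₀ hδ]
    exact Nat.floor_le (by positivity)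
  -- Rounding down costs at most a factor 2: `1 / δ < N + 1 ≤ 2 N`.
  have hN' : 1 ≤ 2 * δ * N := by
    have h2 : 1 / δ < N + 1 := Nat.lt_floor_add_one _
    have h3 : (1 : ℝ) ≤ N := by exact_mod_cast hN1
    rw [div_lt_iff₀ hδ] at h2
    nlinarith
  set T : ℕ → Set (Space d) := fun k => {x | x + (-(k * δ)) • e ∈ A}
  have hT : ∀ k, MeasurableSet (T k) := fun k => hAm.preimage (measurable_add_const _)
  have hdisj : Pairwise (Function.onFun Disjoint T) := by
    have key : ∀ i j : ℕ, i < j → Disjoint (T i) (T j) := by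
      intro i j hij
      rw [Set.disjoint_left]
      rintro x ⟨-, h1, h2⟩ ⟨-, h3, h4⟩
      rw [hGe] at h1 h2 h3 h4
      have : (i : ℝ) + 1 ≤ j := by exact_mod_cast hij
      nlinarith
    intro i j hij
    rcases lt_or_gt_of_ne hij with h | h
    · exact key i j h
    · exact (key j i h).symm
  have hsum : (N : ℝ≥0∞) * volume A ≤ volume B := by
    calc (N : ℝ≥0∞) * volume A = ∑ k ∈ Finset.range N, volume (T k) := by
          simp [T, volume_preimage_add_right]
      _ = volume (⋃ k ∈ Finset.range N, T k) :=
          (measure_biUnion_finset (fun i _ j _ hij => hdisj hij) fun k _ => hT k).symm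
      _ ≤ volume B := by
          refine measure_mono (iUnion₂_subset fun k hk x hx => ?_)
          have hk' : (k : ℝ) ≤ N := by exact_mod_cast (Finset.mem_range.1 hk).le
          have h4 : dist (x + (-(k * δ)) • e) p < ρ := hx.1
          have h5 : dist x (x + (-(k * δ)) • e) ≤ 1 := by
            rw [dist_self_add_right, norm_smul, he, mul_one, Real.norm_eq_abs, abs_neg,
              abs_of_nonneg (by positivity)]
            nlinarith
          have := dist_triangle x (x + (-(k * δ)) • e) p
          exact Metric.mem_ball.2 (by linarith)
  calc volume A = 1 * volume A := (one_mul _).symm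
    _ ≤ ENNReal.ofReal (2 * δ * N) * volume A := by
        gcongr
        rw [← ENNReal.ofReal_one]
        exact ENNReal.ofReal_le_ofReal hN'
    _ = ENNReal.ofReal (2 * δ) * (N * volume A) := by
        rw [ENNReal.ofReal_mul (by positivity), ENNReal.ofReal_natCast, mul_assoc]
    _ ≤ _ := by gcongr

/-- The part of `exitVolume` near a boundary point that is covered by a Lipschitz chart. -/
theorem exists_exit_le_of_chart {d : ℕ} {Ω V : Set (Space d)} {p e : Space d}
    {g : (Submodule.span ℝ {e})ᗮ → ℝ} {L : ℝ≥0} (he : ‖e‖ = 1) (hV : IsOpen V) (hp : p ∈ V)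
    (hg : LipschitzWith L g)
    (hΩ : ∀ (z : (Submodule.span ℝ {e})ᗮ) (t : ℝ), (z : Space d) + t • e ∈ V →
      ((z : Space d) + t • e ∈ Ω ↔ t < g z)) :
    ∃ t ∈ 𝓝 p, ∃ C : ℝ≥0, ∃ r > 0, ∀ h : Space d, ‖h‖ < r →
      volume {x | (x ∈ Ω ∧ x + h ∉ Ω) ∧ ∃ y ∈ t, dist x y ≤ ‖h‖} ≤ C * ‖h‖ₑ := by
  obtain ⟨r, hr, hrV⟩ := Metric.isOpen_iff.1 hV p hp
  set P : Space d →L[ℝ] (Submodule.span ℝ {e})ᗮ := (Submodule.span ℝ {e})ᗮ.orthogonalProjectionOnto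
  have hPe : P e = 0 := by
    apply Submodule.orthogonalProjectionOnto_apply_of_mem_orthogonal
    rw [Submodule.orthogonal_orthogonal]
    exact Submodule.mem_span_singleton_self e
  have hdec : ∀ x : Space d, (P x : Space d) + inner ℝ e x • e = x := by
    intro x
    have h1 := (Submodule.span ℝ {e}).starProjection_add_starProjection_orthogonal x
    rw [Submodule.starProjection_unit_singleton ℝ he] at h1
    rw [add_comm]
    exact h1
  -- Signed height above the graph of `g`: inside `V`, the set `Ω` is `{G < 0}`.
  set G : Space d → ℝ := fun x => inner ℝ e x - g (P x) with hGdef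
  have hGm : Measurable G :=
    ((continuous_const.inner continuous_id).sub (hg.continuous.comp P.continuous)).measurable
  have hGe : ∀ x t, G (x + t • e) = G x + t := by
    intro x t
    simp only [hGdef, map_add, map_smul, hPe, smul_zero, add_zero, inner_add_right,
      inner_smul_right, real_inner_self_eq_norm_sq, he]
    ring
  have hGΩ : ∀ x ∈ V, (x ∈ Ω ↔ G x < 0) := by
    intro x hx
    have := hΩ (P x) (inner ℝ e x) (by rwa [hdec])
    rw [hdec] at this
    rw [this, hGdef, sub_neg]
  have hGh : ∀ x h, G (x + h) ≤ G x + (1 + L) * ‖h‖ := by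
    intro x h
    have h1 : inner ℝ e h ≤ ‖h‖ := by
      have := real_inner_le_norm e h
      rwa [he, one_mul] at this
    have h2 : g (P x) - g (P (x + h)) ≤ L * ‖h‖ := by
      have h3 := hg.dist_le_mul (P x) (P (x + h))
      have h4 : dist (P x) (P (x + h)) ≤ ‖h‖ := by
        rw [map_add, dist_self_add_right]
        exact Submodule.norm_orthogonalProjectionOnto_apply_le _ h
      rw [Real.dist_eq] at h3
      have h5 : (L : ℝ) * dist (P x) (P (x + h)) ≤ L * ‖h‖ := by gcongr
      linarith [le_abs_self (g (P x) - g (P (x + h)))]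
    simp only [hGdef, inner_add_right]
    linarith
  -- With radius `r / 3` both `x` and `x + h` stay in the chart ball. A point leaving `Ω` then lies
  -- in the strip of height `(1 + L) ‖h‖` below the graph.
  refine ⟨Metric.ball p (r / 3), Metric.ball_mem_nhds p (by positivity),
    (2 * (1 + L)) * (volume (Metric.ball p (r + 1))).toNNReal, r / 3, by positivity, ?_⟩
  intro h hh
  rcases eq_or_ne h 0 with rfl | h0
  · have : {x : Space d | (x ∈ Ω ∧ x + 0 ∉ Ω) ∧ ∃ y ∈ Metric.ball p (r / 3),
        dist x y ≤ ‖(0 : Space d)‖} = ∅ := by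
      ext x
      simp only [add_zero, mem_ofPred_eq, mem_empty_iff_false, iff_false]
      tauto
    rw [this, measure_empty]
    exact zero_le
  have h0' : 0 < ‖h‖ := norm_pos_iff.2 h0
  have hδ : 0 < (1 + L : ℝ) * ‖h‖ := by positivity
  calc volume {x | (x ∈ Ω ∧ x + h ∉ Ω) ∧ ∃ y ∈ Metric.ball p (r / 3), dist x y ≤ ‖h‖}
      ≤ volume {x | x ∈ Metric.ball p r ∧ -((1 + L) * ‖h‖) ≤ G x ∧ G x < 0} := by
        refine measure_mono ?_
        rintro x ⟨⟨hx, hxh⟩, y, hy, hxy⟩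
        have hxp : dist x p < 2 * r / 3 := by
          have := dist_triangle x y p
          have := Metric.mem_ball.1 hy
          linarith
        have hxhp : dist (x + h) p < r := by
          have := dist_triangle (x + h) x p
          rw [dist_self_add_left] at this
          linarith
        have hxr : x ∈ Metric.ball p r := Metric.mem_ball.2 (by linarith)
        refine ⟨hxr, ?_, (hGΩ x (hrV hxr)).1 hx⟩
        have h1 : 0 ≤ G (x + h) := by
          rw [hGΩ _ (hrV (Metric.mem_ball.2 hxhp))] at hxh
          exact not_lt.1 hxh
        linarith [hGh x h]
    _ ≤ ENNReal.ofReal (2 * ((1 + L) * ‖h‖)) * volume (Metric.ball p (r + 1)) :=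
        volume_strip_le hGm he hGe p r hδ
    _ = _ := by
        rw [ENNReal.coe_mul, ENNReal.coe_toNNReal measure_ball_lt_top.ne, ← mul_assoc,
          ENNReal.ofReal_mul (by positivity), ofReal_norm]
        have : ENNReal.ofReal (2 * (1 + L)) = ((2 * (1 + L) : ℝ≥0) : ℝ≥0∞) := by
          rw [← ENNReal.ofReal_coe_nnreal]
          simp
        rw [this]
        ring

/-- A bounded set with Lipschitz boundary has finite perimeter, in the sense that translations by
`h` move a volume at most proportional to `‖h‖` out of it. -/
theorem exists_exitVolume_le {d : ℕ} {Ω : Set (Space d)} (hb : Bornology.IsBounded Ω)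
    (hΩ : HasLipschitzBoundary Ω) :
    ∃ C : ℝ≥0, ∀ h, exitVolume Ω h ≤ C * ‖h‖ₑ := by
  have hcomp : IsCompact (frontier Ω) :=
    Metric.isCompact_of_isClosed_isBounded isClosed_frontier
      (hb.closure.subset frontier_subset_closure)
  have key : ∃ C : ℝ≥0, ∃ r > 0, ∀ h : Space d, ‖h‖ < r →
      volume {x | (x ∈ Ω ∧ x + h ∉ Ω) ∧ ∃ y ∈ frontier Ω, dist x y ≤ ‖h‖} ≤ C * ‖h‖ₑ := by
    refine hcomp.induction_on (p := fun S => ∃ C : ℝ≥0, ∃ r > 0, ∀ h : Space d, ‖h‖ < r →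
      volume {x | (x ∈ Ω ∧ x + h ∉ Ω) ∧ ∃ y ∈ S, dist x y ≤ ‖h‖} ≤ C * ‖h‖ₑ) ?_ ?_ ?_ ?_
    · exact ⟨0, 1, one_pos, fun h _ => by simp⟩
    · rintro s t hst ⟨C, r, hr, H⟩
      refine ⟨C, r, hr, fun h hh => (measure_mono ?_).trans (H h hh)⟩
      rintro x ⟨hx, y, hy, hxy⟩
      exact ⟨hx, y, hst hy, hxy⟩
    · rintro s t ⟨C, r, hr, H⟩ ⟨C', r', hr', H'⟩
      refine ⟨C + C', min r r', lt_min hr hr', fun h hh => ?_⟩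
      calc _ ≤ volume ({x | (x ∈ Ω ∧ x + h ∉ Ω) ∧ ∃ y ∈ s, dist x y ≤ ‖h‖} ∪
            {x | (x ∈ Ω ∧ x + h ∉ Ω) ∧ ∃ y ∈ t, dist x y ≤ ‖h‖}) := by
            refine measure_mono ?_
            rintro x ⟨hx, y, hy | hy, hxy⟩
            · exact Or.inl ⟨hx, y, hy, hxy⟩
            · exact Or.inr ⟨hx, y, hy, hxy⟩
        _ ≤ _ := measure_union_le _ _
        _ ≤ C * ‖h‖ₑ + C' * ‖h‖ₑ :=
            add_le_add (H h (hh.trans_le (min_le_left _ _))) (H' h (hh.trans_le (min_le_right _ _)))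
        _ = _ := by rw [ENNReal.coe_add, add_mul]
    · intro p hp
      obtain ⟨e, V, g, L, he, hV, hpV, hg, H⟩ := hΩ p hp
      obtain ⟨t, ht, H⟩ := exists_exit_le_of_chart he hV hpV hg H
      exact ⟨t, mem_nhdsWithin_of_mem_nhds ht, H⟩
  obtain ⟨C, r, hr, H⟩ := key
  -- The second summand serves long shifts, where `volume Ω ≤ (volume Ω / r) ‖h‖`.
  refine ⟨C + (volume Ω).toNNReal / r.toNNReal, fun h => ?_⟩
  rcases lt_or_ge ‖h‖ r with hh | hh
  · calc exitVolume Ω h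
        ≤ volume {x | (x ∈ Ω ∧ x + h ∉ Ω) ∧ ∃ y ∈ frontier Ω, dist x y ≤ ‖h‖} := by
          refine measure_mono ?_
          rintro x ⟨hx, hxh⟩
          -- The distance from `x` to the complement is attained on the frontier, and it is at most
          -- `‖h‖` because `x + h` is outside.
          obtain ⟨y, hy, hxy⟩ := exists_mem_frontier_infDist_compl_eq_dist hx
            (fun hu => hxh (hu ▸ mem_univ _))
          refine ⟨⟨hx, hxh⟩, y, hy, ?_⟩
          rw [← hxy]
          refine (Metric.infDist_le_dist_of_mem (y := x + h) hxh).trans ?_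
          rw [dist_self_add_right]
      _ ≤ C * ‖h‖ₑ := H h hh
      _ ≤ _ := by
          gcongr
          exact le_self_add
  · calc exitVolume Ω h ≤ volume Ω := measure_mono fun x hx => hx.1
      _ = ((volume Ω).toNNReal / r.toNNReal : ℝ≥0) * (r.toNNReal : ℝ≥0∞) := by
          rw [← ENNReal.coe_mul, div_mul_cancel₀ _ (Real.toNNReal_pos.2 hr).ne',
            ENNReal.coe_toNNReal hb.measure_lt_top.ne]
      _ ≤ _ := by
          gcongr
          · exact le_add_self
          · rw [← ofReal_norm]
            exact ENNReal.ofReal_le_ofReal hh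

/-! ### Subadditivity and symmetry of the exit volume -/

theorem exitVolume_zero {d : ℕ} (E : Set (Space d)) : exitVolume E 0 = 0 := by
  simp [exitVolume]

/-- A point that leaves after `h + k` leaves either in the first step or in the second. -/
theorem exitVolume_add_le {d : ℕ} (E : Set (Space d)) (h k : Space d) :
    exitVolume E (h + k) ≤ exitVolume E h + exitVolume E k := by
  calc exitVolume E (h + k)
      ≤ volume ({x | x ∈ E ∧ x + h ∉ E} ∪ {x | x + h ∈ {y | y ∈ E ∧ y + k ∉ E}}) := by
        refine measure_mono ?_
        rintro x ⟨hx, hxh⟩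
        by_cases hxE : x + h ∈ E
        · exact Or.inr ⟨hxE, by rwa [add_assoc]⟩
        · exact Or.inl ⟨hx, hxE⟩
    _ ≤ _ := measure_union_le _ _
    _ = _ := by rw [volume_preimage_add_right]; rfl

theorem exitVolume_nsmul_le {d : ℕ} (E : Set (Space d)) (h : Space d) (m : ℕ) :
    exitVolume E (m • h) ≤ m * exitVolume E h := by
  induction m with
  | zero => simp [exitVolume_zero]
  | succ m ih =>
    rw [succ_nsmul, Nat.cast_add, Nat.cast_one, add_mul, one_mul]
    exact (exitVolume_add_le E _ _).trans (by gcongr)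

/-- The points of `E` that stay under `h` and those that stay under `-h` are translates of each
other; finiteness allows cancelling their volume from that of `E`. -/
theorem exitVolume_neg {d : ℕ} {E : Set (Space d)} (hE : MeasurableSet E)
    (hfin : volume E ≠ ∞) (h : Space d) : exitVolume E (-h) = exitVolume E h := by
  have key : ∀ k : Space d, volume {x | x ∈ E ∧ x + k ∈ E} + exitVolume E k = volume E :=
    fun k => measure_inter_add_sdiff E (hE.preimage (measurable_add_const k))
  have hsymm : volume {x | x ∈ E ∧ x + -h ∈ E} = volume {x | x ∈ E ∧ x + h ∈ E} := by
    rw [← volume_preimage_add_right {x | x ∈ E ∧ x + -h ∈ E} h]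
    congr 1
    ext x
    simp [and_comm]
  have h1 := key h
  rw [← key (-h), hsymm] at h1
  have : volume {x | x ∈ E ∧ x + h ∈ E} ≠ ∞ :=
    ne_top_of_le_ne_top hfin (measure_mono fun x hx => hx.1)
  exact ((ENNReal.add_right_inj this).1 h1).symm

theorem measurable_exitVolume {d : ℕ} {E : Set (Space d)} (hE : MeasurableSet E) :
    Measurable (exitVolume E) := by
  have : MeasurableSet {p : Space d × Space d | p.2 ∈ E ∧ p.2 + p.1 ∉ E} :=
    (hE.preimage measurable_snd).inter
      (hE.preimage (measurable_snd.add measurable_fst)).compl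
  exact measurable_measure_prodMk_left this

/-- A subadditive bound: control of `exitVolume` at scale `ρ` gives linear growth. -/
theorem exitVolume_le_of_forall_norm_le {d : ℕ} {E : Set (Space d)} {ρ : ℝ} (hρ : 0 < ρ)
    {B : ℝ≥0∞} (hB : ∀ h, ‖h‖ ≤ ρ → exitVolume E h ≤ B) (h : Space d) :
    exitVolume E h ≤ ENNReal.ofReal (‖h‖ / ρ + 1) * B := by
  rcases eq_or_ne h 0 with rfl | h0
  · rw [exitVolume_zero]
    exact zero_le
  have h0' : 0 < ‖h‖ := norm_pos_iff.2 h0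
  -- Cut `h` into `m` equal steps, the least number that makes each of length at most `ρ`.
  set m := ⌈‖h‖ / ρ⌉₊
  have hm : 0 < m := Nat.ceil_pos.2 (by positivity)
  have hm' : (0 : ℝ) < m := by exact_mod_cast hm
  have hh : m • ((m : ℝ)⁻¹ • h) = h := by
    rw [← Nat.cast_smul_eq_nsmul ℝ, smul_smul, mul_inv_cancel₀ hm'.ne', one_smul]
  calc exitVolume E h = exitVolume E (m • ((m : ℝ)⁻¹ • h)) := by rw [hh]
    _ ≤ m * exitVolume E ((m : ℝ)⁻¹ • h) := exitVolume_nsmul_le _ _ _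
    _ ≤ ENNReal.ofReal (‖h‖ / ρ + 1) * B := by
      gcongr
      · rw [← ENNReal.ofReal_natCast]
        exact ENNReal.ofReal_le_ofReal (Nat.ceil_lt_add_one (by positivity)).le
      · apply hB
        rw [norm_smul, norm_inv, Real.norm_natCast, inv_mul_le_iff₀ hm', ← div_le_iff₀ hρ]
        exact Nat.le_ceil _

/-! ### From averages over `A` to single shifts -/

open scoped Pointwise in
-- Steinhaus: for a compact `S ⊆ A` of positive measure, `(h + S) \ S` has vanishing measure as `h →
-- 0`, so `(h + S) ∩ S` keeps half of `S`. Symmetry of `A` turns `a - h ∈ A` into `h - a ∈ A`.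
theorem exists_le_volume_inter_translate {d : ℕ} {A : Set (Space d)} (hA : MeasurableSet A)
    (hneg : ∀ h ∈ A, -h ∈ A) (hpos : volume A ≠ 0) :
    ∃ c : ℝ≥0, c ≠ 0 ∧ ∃ r > 0, ∀ h : Space d, ‖h‖ ≤ r → c ≤ volume {a | a ∈ A ∧ h - a ∈ A} := by
  obtain ⟨S, hSA, hS, hSpos⟩ := hA.exists_lt_isCompact (pos_iff_ne_zero.2 hpos)
  have hSfin : volume S ≠ ∞ := hS.measure_lt_top.ne
  have hlim := tendsto_measure_vadd_sdiff_isCompact_isClosed (μ := volume) hS hS.isClosed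
  have hhalf : 0 < volume S / 2 := ENNReal.half_pos hSpos.ne'
  have hev := hlim.eventually (gt_mem_nhds hhalf)
  obtain ⟨r, hr, H⟩ := Metric.eventually_nhds_iff.1 hev
  refine ⟨(volume S / 2).toNNReal, ?_, r / 2, by positivity, fun h hh => ?_⟩
  · rw [ENNReal.toNNReal_ne_zero]
    exact ⟨hhalf.ne', (ENNReal.half_lt_self hSpos.ne' hSfin).ne_top⟩
  rw [ENNReal.coe_toNNReal (ENNReal.half_lt_self hSpos.ne' hSfin).ne_top]
  have h1 : volume ((h +ᵥ S) \ S) < volume S / 2 := H (by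
    rw [dist_zero_right]
    linarith)
  have h2 : volume S ≤ volume ((h +ᵥ S) ∩ S) + volume ((h +ᵥ S) \ S) := by
    rw [measure_inter_add_sdiff _ hS.measurableSet, measure_vadd]
  have h3 : volume S / 2 ≤ volume ((h +ᵥ S) ∩ S) := by
    by_contra! hlt
    have := h2.trans_lt (ENNReal.add_lt_add hlt h1)
    rw [ENNReal.add_halves] at this
    exact lt_irrefl _ this
  refine h3.trans (measure_mono ?_)
  rintro a ⟨⟨s, hs, rfl⟩, haS⟩
  refine ⟨hSA haS, ?_⟩
  have : h - (h +ᵥ s) = -s := by rw [vadd_eq_add]; abel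
  change h - (h +ᵥ s) ∈ A
  rw [this]
  exact hneg s (hSA hs)

/-- Integrate subadditivity for `ε h = ε a + ε (h - a)` over the admissible `a`; the substitution `a
↦ h - a` makes the two terms equal. -/
theorem mul_exitVolume_le {d : ℕ} {A E : Set (Space d)} (hA : MeasurableSet A)
    (hE : MeasurableSet E) (ε : ℝ) {c : ℝ≥0} {h : Space d}
    (hc : c ≤ volume {a | a ∈ A ∧ h - a ∈ A}) :
    c * exitVolume E (ε • h) ≤ 2 * ∫⁻ a in A, exitVolume E (ε • a) := by
  have hm : Measurable fun a : Space d => exitVolume E (ε • a) :=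
    (measurable_exitVolume hE).comp (measurable_const_smul ε)
  have hm' : Measurable (A.indicator fun a : Space d => exitVolume E (ε • a)) :=
    hm.indicator hA
  have hA' : MeasurableSet {a | a ∈ A ∧ h - a ∈ A} :=
    hA.inter (hA.preimage (measurable_const.sub measurable_id))
  calc c * exitVolume E (ε • h)
      ≤ volume {a | a ∈ A ∧ h - a ∈ A} * exitVolume E (ε • h) := by gcongr
    _ = ∫⁻ a in {a | a ∈ A ∧ h - a ∈ A}, exitVolume E (ε • h) := by
        rw [setLIntegral_const, mul_comm]
    _ ≤ ∫⁻ a in {a | a ∈ A ∧ h - a ∈ A},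
          (A.indicator (fun a => exitVolume E (ε • a)) a +
            A.indicator (fun a => exitVolume E (ε • a)) (h - a)) := by
        refine setLIntegral_mono' hA' fun a ha => ?_
        rw [indicator_of_mem ha.1, indicator_of_mem ha.2]
        refine le_of_eq_of_le ?_ (exitVolume_add_le E _ _)
        rw [← smul_add, add_sub_cancel]
    _ ≤ ∫⁻ a, (A.indicator (fun a => exitVolume E (ε • a)) a +
            A.indicator (fun a => exitVolume E (ε • a)) (h - a)) := setLIntegral_le_lintegral _ _
    _ = 2 * ∫⁻ a in A, exitVolume E (ε • a) := by
        rw [lintegral_add_left hm', lintegral_sub_left_eq_self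
          (A.indicator fun a => exitVolume E (ε • a)) h, lintegral_indicator hA, two_mul]

/-! ### The energy controls the average exit volume -/

theorem volume_setOf_scaled_add {d : ℕ} (S : Set (Space d)) (x : Space d) {ε : ℝ} (hε : 0 < ε) :
    volume {h | x + ε • h ∈ S} = ENNReal.ofReal (1 / ε ^ d) * volume S := by
  have h1 := Measure.addHaar_preimage_smul (volume : Measure (Space d)) hε.ne' ((x + ·) ⁻¹' S)
  rw [measure_preimage_add, finrank_euclideanSpace_fin, abs_of_pos (by positivity),
    ← one_div] at h1
  exact h1

/-- Fubini, then the change of variables `y = x + ε h`, whose Jacobian is the factor in `rescale`.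
-/
theorem lintegral_volume_crossing {d : ℕ} {A E B : Set (Space d)} (hA : MeasurableSet A)
    (hE : MeasurableSet E) (hB : MeasurableSet B) {ε : ℝ} (hε : 0 < ε) :
    ∫⁻ h in A, volume {x | x ∈ E ∧ x + ε • h ∈ B} =
      ∫⁻ x in E, ENNReal.ofReal (1 / ε ^ d) * volume {y | y ∈ B ∧ ε⁻¹ • (y - x) ∈ A} := by
  set S : Set (Space d × Space d) := {p | p.1 ∈ A ∧ p.2 ∈ E ∧ p.2 + ε • p.1 ∈ B}
  have hS : MeasurableSet S :=
    (hA.preimage measurable_fst).inter ((hE.preimage measurable_snd).inter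
      (hB.preimage (measurable_snd.add (measurable_fst.const_smul ε))))
  have h1 := Measure.prod_apply (μ := (volume : Measure (Space d)))
    (ν := (volume : Measure (Space d))) hS
  have h2 := Measure.prod_apply_symm (μ := (volume : Measure (Space d)))
    (ν := (volume : Measure (Space d))) hS
  rw [← lintegral_indicator hA, ← lintegral_indicator hE]
  calc _ = ∫⁻ h, volume (Prod.mk h ⁻¹' S) := by
        refine lintegral_congr fun h => ?_
        by_cases hh : h ∈ A
        · rw [indicator_of_mem hh]
          congr 1
          ext x
          simp [S, hh]
        · rw [indicator_of_notMem hh]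
          have : Prod.mk h ⁻¹' S = ∅ := by
            ext x
            simp [S, hh]
          rw [this, measure_empty]
    _ = ∫⁻ x, volume ((fun h => (h, x)) ⁻¹' S) := h1.symm.trans h2
    _ = _ := by
        refine lintegral_congr fun x => ?_
        by_cases hx : x ∈ E
        · rw [indicator_of_mem hx, ← volume_setOf_scaled_add _ x hε]
          congr 1
          ext h
          simp [S, hx, smul_smul, inv_mul_cancel₀ hε.ne', and_comm]
        · rw [indicator_of_notMem hx]
          have : (fun h => (h, x)) ⁻¹' S = ∅ := by
            ext h
            simp [S, hx]
          rw [this, measure_empty]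

/-- On pairs `x ∈ E`, `y ∈ Ω \ E` the characteristic functions differ by 1, and the kernel is at
least `δ / ε ^ d` when the rescaled difference lies in `A`. -/
theorem lintegral_volume_crossing_le_localEnergy {d : ℕ} {A E Ω : Set (Space d)}
    (hA : MeasurableSet A) (hE : MeasurableSet E) (hΩ : MeasurableSet Ω) (hEΩ : E ⊆ Ω)
    {K : Space d → ℝ} {δ : ℝ} (hδ : 0 < δ) (hK : ∀ h ∈ A, δ ≤ K h) {ε : ℝ} (hε : 0 < ε) :
    ∫⁻ h in A, volume {x | x ∈ E ∧ x + ε • h ∈ Ω \ E} ≤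
      ENNReal.ofReal (1 / δ) * localEnergy (rescale K ε) (charFn E) Ω := by
  rw [lintegral_volume_crossing hA hE (hΩ.diff hE) hε, localEnergy,
    ← lintegral_const_mul' _ _ ENNReal.ofReal_ne_top]
  refine (setLIntegral_mono' hE fun x hx => ?_).trans (lintegral_mono_set hEΩ)
  set S : Set (Space d) := {y | y ∈ Ω \ E ∧ ε⁻¹ • (y - x) ∈ A}
  have hS : MeasurableSet S :=
    (hΩ.diff hE).inter (hA.preimage ((measurable_id.sub_const x).const_smul ε⁻¹))
  rw [← setLIntegral_const, ← lintegral_const_mul' _ _ ENNReal.ofReal_ne_top]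
  refine (setLIntegral_mono' hS fun y hy => ?_).trans (lintegral_mono_set fun y hy => hy.1.1)
  rw [← ENNReal.ofReal_mul (by positivity)]
  refine ENNReal.ofReal_le_ofReal ?_
  simp only [charFn, indicator_of_notMem hy.1.2, indicator_of_mem hx, rescale]
  have := hK _ hy.2
  rw [zero_sub, abs_neg, abs_one, mul_one, mul_left_comm]
  refine le_mul_of_one_le_right (by positivity) ?_
  rwa [one_div, inv_mul_eq_div, one_le_div hδ]

/-- The nonlocal energy in `Ω` and the exit volume of `Ω` control the average exit volume. -/
theorem lintegral_exitVolume_le {d : ℕ} {A E Ω : Set (Space d)} (hA : MeasurableSet A)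
    (hE : MeasurableSet E) (hΩ : MeasurableSet Ω) (hEΩ : E ⊆ Ω) {K : Space d → ℝ} {δ : ℝ}
    (hδ : 0 < δ) (hK : ∀ h ∈ A, δ ≤ K h) {ε : ℝ} (hε : 0 < ε) :
    ∫⁻ h in A, exitVolume E (ε • h) ≤
      ENNReal.ofReal (1 / δ) * localEnergy (rescale K ε) (charFn E) Ω +
        ∫⁻ h in A, exitVolume Ω (ε • h) := by
  have hm : Measurable fun h : Space d => exitVolume Ω (ε • h) :=
    (measurable_exitVolume hΩ).comp (measurable_const_smul ε)
  calc ∫⁻ h in A, exitVolume E (ε • h)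
      ≤ ∫⁻ h in A, (volume {x | x ∈ E ∧ x + ε • h ∈ Ω \ E} + exitVolume Ω (ε • h)) := by
        refine lintegral_mono fun h => ?_
        refine (measure_mono ?_).trans (measure_union_le _ _)
        rintro x ⟨hx, hxh⟩
        by_cases hxΩ : x + ε • h ∈ Ω
        · exact Or.inl ⟨hx, hxΩ, hxh⟩
        · exact Or.inr ⟨hEΩ hx, hxΩ⟩
    _ = _ := lintegral_add_right _ hm
    _ ≤ _ := by
        gcongr
        exact lintegral_volume_crossing_le_localEnergy hA hE hΩ hEΩ hδ hK hε

/-! ### A set where the kernel is bounded below -/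

theorem volume_norm_preimage_eq_zero {d : ℕ} (hd : 1 ≤ d) {N : Set ℝ} (hN : MeasurableSet N)
    (hN0 : volume.restrict (Ici (0 : ℝ)) N = 0) : volume {h : Space d | ‖h‖ ∈ N} = 0 := by
  have : Nonempty (Fin d) := ⟨⟨0, hd⟩⟩
  -- Polar coordinates; the truncation makes the volume finite, so that a zero Bochner integral
  -- means measure zero.
  have key : ∀ m : ℕ, volume {h : Space d | ‖h‖ ∈ N ∩ Iic (m : ℝ)} = 0 := by
    intro m
    have hNm : MeasurableSet (N ∩ Iic (m : ℝ)) := hN.inter measurableSet_Iic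
    have hset : MeasurableSet {h : Space d | ‖h‖ ∈ N ∩ Iic (m : ℝ)} := hNm.preimage measurable_norm
    have h1 := integral_fun_norm_addHaar (volume : Measure (Space d))
      ((N ∩ Iic (m : ℝ)).indicator (fun _ => (1 : ℝ)))
    have h2 : ∫ y in Ioi (0 : ℝ), y ^ (Module.finrank ℝ (Space d) - 1) •
        (N ∩ Iic (m : ℝ)).indicator (fun _ => (1 : ℝ)) y = 0 := by
      apply integral_eq_zero_of_ae
      have : volume.restrict (Ioi (0 : ℝ)) N = 0 := by rwa [restrict_Ioi_eq_restrict_Ici]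
      filter_upwards [measure_eq_zero_iff_ae_notMem.1 this] with y hy
      rw [indicator_of_notMem fun h => hy h.1, smul_zero]
      rfl
    have h3 : ∫ x : Space d, (N ∩ Iic (m : ℝ)).indicator (fun _ => (1 : ℝ)) ‖x‖ =
        volume.real {h : Space d | ‖h‖ ∈ N ∩ Iic (m : ℝ)} := by
      rw [← integral_indicator_one hset]
      rfl
    have hfin : volume {h : Space d | ‖h‖ ∈ N ∩ Iic (m : ℝ)} ≠ ∞ := by
      refine ((measure_mono ?_).trans_lt
        (measure_closedBall_lt_top (x := (0 : Space d)) (r := m))).ne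
      intro h hh
      simpa using hh.2
    rwa [h2, smul_zero, smul_zero, h3, measureReal_eq_zero_iff hfin] at h1
  refine measure_mono_null ?_ (measure_iUnion_null key)
  intro h hh
  obtain ⟨m, hm⟩ := exists_nat_ge ‖h‖
  exact mem_iUnion.2 ⟨m, hh, hm⟩

/-- Up to null sets, `{K > 0}` is the countable union of the sets `{‖h‖ ≤ m, 1 / (m + 1) ≤ K}`, so
one of them has positive measure. Radiality makes it symmetric. -/
theorem exists_set_le_radialKernel {d : ℕ} (hd : 1 ≤ d) {Kbar : ℝ → ℝ}
    (hK_nonneg : ∀ r, 0 ≤ r → 0 ≤ Kbar r)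
    (hK_meas : AEMeasurable Kbar (volume.restrict (Ici 0)))
    (hK_ne : ¬ radialKernel d Kbar =ᵐ[volume] 0) :
    ∃ δ > 0, ∃ R : ℝ, ∃ A : Set (Space d), MeasurableSet A ∧ (∀ h ∈ A, -h ∈ A) ∧
      volume A ≠ 0 ∧ (∀ h ∈ A, ‖h‖ ≤ R) ∧ ∀ h ∈ A, δ ≤ radialKernel d Kbar h := by
  set N := toMeasurable (volume.restrict (Ici (0 : ℝ))) {r | Kbar r ≠ hK_meas.mk Kbar r}
  have hN : MeasurableSet N := measurableSet_toMeasurable _ _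
  have hN0 : volume.restrict (Ici (0 : ℝ)) N = 0 := by
    rw [measure_toMeasurable]
    exact hK_meas.ae_eq_mk
  have hNeq : ∀ r ∉ N, Kbar r = hK_meas.mk Kbar r := by
    intro r hr
    by_contra hne
    exact hr (subset_toMeasurable _ _ hne)
  set T : ℕ → Set ℝ := fun m => {r | r ≤ m ∧ 1 / ((m : ℝ) + 1) ≤ hK_meas.mk Kbar r} \ N
  have hT : ∀ m, MeasurableSet (T m) := fun m =>
    (measurableSet_Iic.inter (measurableSet_le measurable_const hK_meas.measurable_mk)).diff hN
  have hex : ∃ m, volume {h : Space d | ‖h‖ ∈ T m} ≠ 0 := by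
    by_contra! hall
    apply hK_ne
    have h0 : volume ({h : Space d | ‖h‖ ∈ N} ∪ ⋃ m, {h : Space d | ‖h‖ ∈ T m}) = 0 :=
      measure_union_null (volume_norm_preimage_eq_zero hd hN hN0) (measure_iUnion_null hall)
    filter_upwards [measure_eq_zero_iff_ae_notMem.1 h0] with h hh
    simp only [mem_union, mem_iUnion, not_or, not_exists] at hh
    refine le_antisymm ?_ (hK_nonneg _ (norm_nonneg h))
    by_contra! hpos
    change 0 < Kbar ‖h‖ at hpos
    obtain ⟨m₁, hm₁⟩ := exists_nat_ge ‖h‖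
    obtain ⟨m₂, hm₂⟩ := exists_nat_one_div_lt hpos
    refine hh.2 (max m₁ m₂) ⟨⟨hm₁.trans (by simp), ?_⟩, hh.1⟩
    rw [← hNeq _ hh.1]
    refine le_trans ?_ hm₂.le
    have : (m₂ : ℝ) ≤ (max m₁ m₂ : ℕ) := by exact_mod_cast le_max_right _ _
    gcongr
  obtain ⟨m, hm⟩ := hex
  refine ⟨1 / ((m : ℝ) + 1), by positivity, m, {h | ‖h‖ ∈ T m}, (hT m).preimage measurable_norm,
    fun h hh => ?_, hm, fun h hh => hh.1.1, fun h hh => ?_⟩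
  · change ‖-h‖ ∈ T m
    rwa [norm_neg]
  · change _ ≤ Kbar ‖h‖
    rw [hNeq _ hh.2]
    exact hh.1.2

/-! ### The key estimate -/

/-- Bounded rescaled energies give exit volumes that grow linearly, uniformly down to the
scale `ε`. -/
theorem exists_forall_exitVolume_le {d : ℕ} {Ω A : Set (Space d)} (hΩ : MeasurableSet Ω)
    {K : Space d → ℝ} {CΩ : ℝ≥0} (hCΩ : ∀ h, exitVolume Ω h ≤ CΩ * ‖h‖ₑ)
    (hA : MeasurableSet A) (hneg : ∀ h ∈ A, -h ∈ A) (hpos : volume A ≠ 0) {R δ : ℝ}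
    (hR : ∀ h ∈ A, ‖h‖ ≤ R) (hδ : 0 < δ) (hK : ∀ h ∈ A, δ ≤ K h) (C : ℝ≥0) :
    ∃ M : ℝ≥0, ∀ (ε : ℝ) (E : Set (Space d)), 0 < ε → MeasurableSet E → E ⊆ Ω →
      ENNReal.ofReal (1 / ε) * localEnergy (rescale K ε) (charFn E) Ω ≤ C →
      ∀ h, exitVolume E h ≤ M * ENNReal.ofReal (‖h‖ + ε) := by
  obtain ⟨c, hc, r, hr, hcr⟩ := exists_le_volume_inter_translate hA hneg hpos
  have hAfin : volume A ≠ ∞ :=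
    (Metric.isBounded_iff_subset_closedBall (0 : Space d)).2
      ⟨R, fun h hh => by simpa using hR h hh⟩ |>.measure_lt_top.ne
  -- The first term comes from the energy; the second is the loss of `Ω`, at most `CΩ R ε`,
  -- integrated over `A`.
  set C₁ : ℝ≥0 := (1 / δ).toNNReal * C + CΩ * R.toNNReal * (volume A).toNNReal
  have hI : ∀ (ε : ℝ) (E : Set (Space d)), 0 < ε → MeasurableSet E → E ⊆ Ω →
      ENNReal.ofReal (1 / ε) * localEnergy (rescale K ε) (charFn E) Ω ≤ C →
      ∫⁻ a in A, exitVolume E (ε • a) ≤ C₁ * ENNReal.ofReal ε := by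
    intro ε E hε hE hEΩ hJ
    have hJ' : localEnergy (rescale K ε) (charFn E) Ω ≤ C * ENNReal.ofReal ε := by
      calc localEnergy (rescale K ε) (charFn E) Ω
          = ENNReal.ofReal (1 / ε) * localEnergy (rescale K ε) (charFn E) Ω *
              ENNReal.ofReal ε := by
            rw [mul_right_comm, ← ENNReal.ofReal_mul (by positivity), one_div,
              inv_mul_cancel₀ hε.ne', ENNReal.ofReal_one, one_mul]
        _ ≤ _ := by gcongr
    have hΩI : ∫⁻ a in A, exitVolume Ω (ε • a) ≤
        CΩ * (R.toNNReal * ENNReal.ofReal ε) * volume A := by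
      rw [← setLIntegral_const]
      refine setLIntegral_mono' hA fun a ha => (hCΩ _).trans ?_
      gcongr
      rw [enorm_smul, mul_comm, Real.enorm_of_nonneg hε.le, ← ofReal_norm]
      gcongr
      exact ENNReal.ofReal_le_ofReal (hR a ha)
    calc ∫⁻ a in A, exitVolume E (ε • a)
        ≤ ENNReal.ofReal (1 / δ) * (C * ENNReal.ofReal ε) +
            CΩ * (R.toNNReal * ENNReal.ofReal ε) * volume A :=
          (lintegral_exitVolume_le hA hE hΩ hEΩ hδ hK hε).trans (by gcongr)
      _ = _ := by
          simp only [C₁, ENNReal.coe_add, ENNReal.coe_mul, ENNReal.coe_toNNReal hAfin,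
            ENNReal.ofReal]
          ring
  -- `2 C₁ / c` is the bound, per unit of `ε`, for shifts up to `ε r`. Chaining multiplies it by
  -- `‖h‖ / (ε r) + 1`, and `‖h‖ / r + ε ≤ (1 / r + 1) (‖h‖ + ε)`.
  refine ⟨2 * C₁ / c * (1 / r + 1).toNNReal, fun ε E hε hE hEΩ hJ h => ?_⟩
  have hsmall : ∀ k : Space d, ‖k‖ ≤ ε * r →
      exitVolume E k ≤ (2 * C₁ / c : ℝ≥0) * ENNReal.ofReal ε := by
    intro k hk
    have hk' : ‖ε⁻¹ • k‖ ≤ r := by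
      rw [norm_smul, norm_inv, Real.norm_of_nonneg hε.le, inv_mul_le_iff₀ hε]
      exact hk
    have h1 := (mul_exitVolume_le hA hE ε (hcr _ hk')).trans
      (mul_le_mul_right (hI ε E hε hE hEΩ hJ) 2)
    rw [smul_smul, mul_inv_cancel₀ hε.ne', one_smul] at h1
    rw [ENNReal.coe_div hc, div_eq_mul_inv, mul_right_comm, ← div_eq_mul_inv,
      ENNReal.le_div_iff_mul_le (Or.inl (by exact_mod_cast hc)) (Or.inl ENNReal.coe_ne_top),
      mul_comm]
    refine h1.trans (le_of_eq ?_)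
    push_cast
    ring
  calc exitVolume E h
      ≤ ENNReal.ofReal (‖h‖ / (ε * r) + 1) * ((2 * C₁ / c : ℝ≥0) * ENNReal.ofReal ε) :=
        exitVolume_le_of_forall_norm_le (by positivity) hsmall h
    _ = (2 * C₁ / c : ℝ≥0) * ENNReal.ofReal (‖h‖ / r + ε) := by
        rw [mul_left_comm, ← ENNReal.ofReal_mul (by positivity)]
        congr 2
        field_simp
    _ ≤ (2 * C₁ / c : ℝ≥0) * ENNReal.ofReal ((1 / r + 1) * (‖h‖ + ε)) := by
        gcongr
        have h1 : (1 / r + 1) * (‖h‖ + ε) = ‖h‖ / r + ε + (ε / r + ‖h‖) := by ring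
        have : 0 ≤ ε / r + ‖h‖ := by positivity
        linarith
    _ = _ := by
        rw [ENNReal.ofReal_mul (by positivity), ENNReal.coe_mul, mul_assoc]
        rfl

/-! ### Weak compactness -/

/-- Sequential Banach–Alaoglu, transported by the Riesz isometry. -/
theorem exists_subseq_forall_tendsto_inner {H : Type*} [NormedAddCommGroup H]
    [InnerProductSpace ℝ H] [CompleteSpace H] [TopologicalSpace.SeparableSpace H] {u : ℕ → H}
    {R : ℝ} (hu : ∀ n, ‖u n‖ ≤ R) :
    ∃ k : ℕ → ℕ, StrictMono k ∧
      ∀ w, ∃ l, Tendsto (fun n => inner ℝ (u (k n)) w) atTop (𝓝 l) := by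
  have hcomp := WeakDual.isSeqCompact_closedBall ℝ H 0 R
  obtain ⟨a, -, k, hk, hlim⟩ := hcomp
    (x := fun n => StrongDual.toWeakDual (InnerProductSpace.toDual ℝ H (u n))) (by
      intro n
      simpa using hu n)
  refine ⟨k, hk, fun w => ⟨a w, ?_⟩⟩
  exact ((WeakDual.eval_continuous w).tendsto a).comp hlim

/-- The indicators are bounded in `L²`, and pairing them with the indicator of `B` gives the volume
of the intersection. -/
theorem exists_subseq_forall_tendsto_volume_inter {d : ℕ} {Ω : Set (Space d)}
    (hΩ : volume Ω ≠ ∞) {E : ℕ → Set (Space d)} (hE : ∀ n, MeasurableSet (E n))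
    (hEΩ : ∀ n, E n ⊆ Ω) :
    ∃ k : ℕ → ℕ, StrictMono k ∧ ∀ B : Set (Space d), MeasurableSet B → volume B ≠ ∞ →
      ∃ l, Tendsto (fun n => volume.real (E (k n) ∩ B)) atTop (𝓝 l) := by
  have hfin : ∀ n, volume (E n) ≠ ∞ := fun n => ne_top_of_le_ne_top hΩ (measure_mono (hEΩ n))
  have : Fact ((2 : ℝ≥0∞) ≠ ∞) := ⟨ENNReal.ofNat_ne_top⟩
  obtain ⟨k, hk, H⟩ := exists_subseq_forall_tendsto_inner
    (u := fun n => indicatorConstLp 2 (hE n) (hfin n) (1 : ℝ))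
    (R := volume.real Ω ^ (1 / (2 : ℝ≥0∞).toReal)) (by
      intro n
      rw [norm_indicatorConstLp two_ne_zero ENNReal.ofNat_ne_top, norm_one, one_mul]
      exact Real.rpow_le_rpow measureReal_nonneg (measureReal_mono (hEΩ n) hΩ) (by positivity))
  refine ⟨k, hk, fun B hB hBfin => ?_⟩
  obtain ⟨l, hl⟩ := H (indicatorConstLp 2 hB hBfin (1 : ℝ))
  refine ⟨l, hl.congr fun n => ?_⟩
  exact L2.real_inner_indicatorConstLp_one_indicatorConstLp_one (hE _) hB (hfin _) hBfin

/-! ### Ball averages and strong compactness in `L¹` -/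

theorem measurable_charFn {d : ℕ} {E : Set (Space d)} (hE : MeasurableSet E) :
    Measurable (charFn E) :=
  measurable_const.indicator hE

theorem enorm_charFn_sub {d : ℕ} (E F : Set (Space d)) (x : Space d) :
    ‖charFn E x - charFn F x‖ₑ = (symmDiff E F).indicator 1 x := by
  by_cases h1 : x ∈ E <;> by_cases h2 : x ∈ F <;> simp [charFn, mem_symmDiff, h1, h2]

theorem eLpNorm_charFn_sub {d : ℕ} {E F : Set (Space d)} (hE : MeasurableSet E)
    (hF : MeasurableSet F) : eLpNorm (charFn E - charFn F) 1 volume = volume (symmDiff E F) := by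
  rw [eLpNorm_one_eq_lintegral_enorm, ← lintegral_indicator_one (hE.symmDiff hF)]
  exact lintegral_congr fun x => enorm_charFn_sub E F x

theorem lintegral_enorm_charFn_sub_translate {d : ℕ} {E : Set (Space d)} (hE : MeasurableSet E)
    (hfin : volume E ≠ ∞) (h : Space d) :
    ∫⁻ x, ‖charFn E x - charFn E (x + h)‖ₑ ≤ 2 * exitVolume E h := by
  have hE' : MeasurableSet ((· + h) ⁻¹' E) := hE.preimage (measurable_add_const h)
  calc ∫⁻ x, ‖charFn E x - charFn E (x + h)‖ₑ
      = volume (symmDiff E ((· + h) ⁻¹' E)) := by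
        rw [← lintegral_indicator_one (hE.symmDiff hE')]
        exact lintegral_congr fun x => enorm_charFn_sub E ((· + h) ⁻¹' E) x
    _ ≤ volume {x | x ∈ E ∧ x + h ∉ E} + volume {x | x + h ∈ {y | y ∈ E ∧ y + -h ∉ E}} := by
        refine (measure_mono ?_).trans (measure_union_le _ _)
        rintro x (⟨h1, h2⟩ | ⟨h1, h2⟩)
        · exact Or.inl ⟨h1, h2⟩
        · exact Or.inr ⟨h1, by simpa using h2⟩
    _ = exitVolume E h + exitVolume E (-h) := by
        rw [volume_preimage_add_right]
        rfl
    _ = _ := by rw [exitVolume_neg hE hfin, two_mul]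

/-- The integral of `χ_E` over the ball of radius `s` centred at `x`. -/
noncomputable def ballIntegral {d : ℕ} (s : ℝ) (E : Set (Space d)) (x : Space d) : ℝ :=
  ∫ h in Metric.ball (0 : Space d) s, charFn E (x + h)

theorem ballIntegral_eq {d : ℕ} (s : ℝ) {E : Set (Space d)} (hE : MeasurableSet E)
    (x : Space d) : ballIntegral s E x = volume.real (E ∩ Metric.ball x s) := by
  have hE' : MeasurableSet ((x + ·) ⁻¹' E) := hE.preimage (measurable_const_add x)
  have h1 : ballIntegral s E x =
      ∫ h in Metric.ball (0 : Space d) s, ((x + ·) ⁻¹' E).indicator 1 h := rfl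
  rw [h1, integral_indicator_one hE', measureReal_restrict_apply hE', measureReal_def,
    measureReal_def]
  congr 1
  rw [← measure_preimage_add volume x (E ∩ Metric.ball x s)]
  congr 1
  ext h
  simp

theorem measurable_ballIntegral {d : ℕ} (s : ℝ) {E : Set (Space d)} (hE : MeasurableSet E) :
    Measurable (ballIntegral s E) := by
  have : StronglyMeasurable fun p : Space d × Space d => charFn E (p.1 + p.2) :=
    ((measurable_charFn hE).comp (measurable_fst.add measurable_snd)).stronglyMeasurable
  exact this.integral_prod_right'.measurable

/-- The difference is the integral of `χ_E(x) - χ_E(x + h)` over the ball of shifts; after Fubini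
each shift costs at most twice its exit volume. -/
theorem lintegral_enorm_ballIntegral_sub_le {d : ℕ} {s : ℝ} {E : Set (Space d)}
    (hE : MeasurableSet E) (hfin : volume E ≠ ∞) {B : ℝ≥0∞}
    (hB : ∀ h, ‖h‖ ≤ s → exitVolume E h ≤ B) :
    ∫⁻ x, ‖volume.real (Metric.ball (0 : Space d) s) * charFn E x - ballIntegral s E x‖ₑ ≤
      2 * B * volume (Metric.ball (0 : Space d) s) := by
  have hm : Measurable fun p : Space d × Space d => ‖charFn E p.1 - charFn E (p.1 + p.2)‖ₑ :=
    (((measurable_charFn hE).comp measurable_fst).sub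
      ((measurable_charFn hE).comp (measurable_fst.add measurable_snd))).enorm
  have hpt : ∀ x, ‖volume.real (Metric.ball (0 : Space d) s) * charFn E x -
      ballIntegral s E x‖ₑ ≤
        ∫⁻ h in Metric.ball (0 : Space d) s, ‖charFn E x - charFn E (x + h)‖ₑ := by
    intro x
    have hint : IntegrableOn (fun h => charFn E (x + h)) (Metric.ball (0 : Space d) s) := by
      refine Measure.integrableOn_of_bounded (M := 1) measure_ball_lt_top.ne
        ((measurable_charFn hE).comp (measurable_const_add x)).aestronglyMeasurable
        (Eventually.of_forall fun h => ?_)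
      by_cases hx : x + h ∈ E <;> simp [charFn, hx]
    have heq : volume.real (Metric.ball (0 : Space d) s) * charFn E x - ballIntegral s E x =
        ∫ h in Metric.ball (0 : Space d) s, (charFn E x - charFn E (x + h)) := by
      have hconst : IntegrableOn (fun _ => charFn E x) (Metric.ball (0 : Space d) s) volume :=
        integrableOn_const measure_ball_lt_top.ne
      rw [integral_sub hconst hint, setIntegral_const, smul_eq_mul]
      rfl
    rw [heq]
    exact enorm_integral_le_lintegral_enorm _
  calc _ ≤ ∫⁻ x, ∫⁻ h in Metric.ball (0 : Space d) s, ‖charFn E x - charFn E (x + h)‖ₑ :=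
        lintegral_mono hpt
    _ = ∫⁻ h in Metric.ball (0 : Space d) s, ∫⁻ x, ‖charFn E x - charFn E (x + h)‖ₑ :=
        lintegral_lintegral_swap hm.aemeasurable
    _ ≤ ∫⁻ _ in Metric.ball (0 : Space d) s, 2 * B := by
        refine setLIntegral_mono' measurableSet_ball fun h hh => ?_
        refine (lintegral_enorm_charFn_sub_translate hE hfin h).trans ?_
        gcongr
        exact hB h (by simpa using (Metric.mem_ball.1 hh).le)
    _ = _ := setLIntegral_const _ _

/-- Testing with `B = ball x s` gives pointwise convergence, and all ball integrals are dominated by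
a constant on one bounded ball. -/
theorem exists_tendsto_lintegral_ballIntegral_sub {d : ℕ} {Ω : Set (Space d)}
    (hΩ : Bornology.IsBounded Ω) {E : ℕ → Set (Space d)} (hE : ∀ n, MeasurableSet (E n))
    (hEΩ : ∀ n, E n ⊆ Ω) (s : ℝ)
    (hconv : ∀ B : Set (Space d), MeasurableSet B → volume B ≠ ∞ →
      ∃ l, Tendsto (fun n => volume.real (E n ∩ B)) atTop (𝓝 l)) :
    ∃ g : Space d → ℝ, Measurable g ∧
      Tendsto (fun n => ∫⁻ x, ‖ballIntegral s (E n) x - g x‖ₑ) atTop (𝓝 0) := by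
  have hex : ∀ x, ∃ l, Tendsto (fun n => ballIntegral s (E n) x) atTop (𝓝 l) := by
    intro x
    obtain ⟨l, hl⟩ := hconv (Metric.ball x s) measurableSet_ball measure_ball_lt_top.ne
    exact ⟨l, hl.congr fun n => (ballIntegral_eq s (hE n) x).symm⟩
  choose g hg using hex
  have hgm : Measurable g :=
    measurable_of_tendsto_metrizable (fun n => measurable_ballIntegral s (hE n))
      (tendsto_pi_nhds.2 hg)
  refine ⟨g, hgm, ?_⟩
  obtain ⟨R, hR⟩ := hΩ.subset_closedBall (0 : Space d)
  set V := volume.real (Metric.ball (0 : Space d) s)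
  set D := Metric.closedBall (0 : Space d) (R + s)
  have hbd : ∀ n x, |ballIntegral s (E n) x| ≤ D.indicator (fun _ => V) x := by
    intro n x
    rw [ballIntegral_eq s (hE n), abs_of_nonneg measureReal_nonneg]
    by_cases hx : x ∈ D
    · rw [indicator_of_mem hx]
      have : volume.real (Metric.ball x s) = V := by
        simp only [V, measureReal_def, Measure.addHaar_ball_center]
      rw [← this]
      exact measureReal_mono inter_subset_right measure_ball_lt_top.ne
    · rw [indicator_of_notMem hx]
      have : E n ∩ Metric.ball x s = ∅ := by
        rw [← disjoint_iff_inter_eq_empty, disjoint_left]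
        intro y hy hyx
        apply hx
        have h1 := Metric.mem_closedBall.1 (hR (hEΩ n hy))
        have h2 := dist_triangle x y 0
        rw [Metric.mem_ball, dist_comm] at hyx
        exact Metric.mem_closedBall.2 (by linarith)
      rw [this, measureReal_empty]
  have hgbd : ∀ x, |g x| ≤ D.indicator (fun _ => V) x := fun x =>
    le_of_tendsto (hg x).abs (Eventually.of_forall fun n => hbd n x)
  have hlim := tendsto_lintegral_of_dominated_convergence (μ := (volume : Measure (Space d)))
    (F := fun n x => ‖ballIntegral s (E n) x - g x‖ₑ) (f := fun _ => 0)
    (fun x => D.indicator (fun _ => ENNReal.ofReal (2 * V)) x)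
    (fun n => ((measurable_ballIntegral s (hE n)).sub hgm).enorm)
    (fun n => Eventually.of_forall fun x => by
      have h1 := hbd n x
      have h2 := hgbd x
      have h3 := abs_sub (ballIntegral s (E n) x) (g x)
      simp only
      rw [Real.enorm_eq_ofReal_abs]
      by_cases hx : x ∈ D
      · rw [indicator_of_mem hx] at h1 h2 ⊢
        exact ENNReal.ofReal_le_ofReal (by linarith)
      · rw [indicator_of_notMem hx] at h1 h2 ⊢
        exact (ENNReal.ofReal_eq_zero.2 (by linarith)).le)
    (by
      rw [lintegral_indicator measurableSet_closedBall, setLIntegral_const]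
      exact ENNReal.mul_ne_top ENNReal.ofReal_ne_top measure_closedBall_lt_top.ne)
    (Eventually.of_forall fun x => by
      have := ((hg x).sub_const (g x)).enorm
      simpa using this)
  simpa using hlim

theorem memLp_charFn {d : ℕ} {E : Set (Space d)} (hE : MeasurableSet E) (hfin : volume E ≠ ∞) :
    MemLp (charFn E) 1 volume :=
  memLp_indicator_const 1 hE 1 (Or.inr hfin)

theorem mul_eLpNorm_charFn_sub_le {d : ℕ} {s : ℝ} {E F : Set (Space d)} (hE : MeasurableSet E)
    (hF : MeasurableSet F) {g : Space d → ℝ} (hg : Measurable g) :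
    volume (Metric.ball (0 : Space d) s) * eLpNorm (charFn E - charFn F) 1 volume ≤
      ((∫⁻ x, ‖volume.real (Metric.ball (0 : Space d) s) * charFn E x - ballIntegral s E x‖ₑ) +
        ∫⁻ x, ‖ballIntegral s E x - g x‖ₑ) +
      ((∫⁻ x, ‖volume.real (Metric.ball (0 : Space d) s) * charFn F x - ballIntegral s F x‖ₑ) +
        ∫⁻ x, ‖ballIntegral s F x - g x‖ₑ) := by
  set V := volume.real (Metric.ball (0 : Space d) s)
  have hV : volume (Metric.ball (0 : Space d) s) = ‖V‖ₑ := by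
    rw [Real.enorm_of_nonneg measureReal_nonneg, ofReal_measureReal measure_ball_lt_top.ne]
  have hm : ∀ {G : Set (Space d)}, MeasurableSet G →
      Measurable fun x => ‖V * charFn G x - ballIntegral s G x‖ₑ := fun hG =>
    (((measurable_charFn hG).const_mul V).sub (measurable_ballIntegral s hG)).enorm
  have hm' : ∀ {G : Set (Space d)}, MeasurableSet G →
      Measurable fun x => ‖ballIntegral s G x - g x‖ₑ := fun hG =>
    ((measurable_ballIntegral s hG).sub hg).enorm
  have hsum : Measurable fun x => ‖V * charFn E x - ballIntegral s E x‖ₑ +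
      ‖ballIntegral s E x - g x‖ₑ := (hm hE).add (hm' hE)
  rw [eLpNorm_one_eq_lintegral_enorm, ← lintegral_const_mul' _ _ measure_ball_lt_top.ne,
    ← lintegral_add_left (hm hE), ← lintegral_add_left (hm hF), ← lintegral_add_left hsum]
  refine lintegral_mono fun x => ?_
  simp only [Pi.sub_apply, hV]
  rw [← enorm_mul]
  have : V * (charFn E x - charFn F x) =
      ((V * charFn E x - ballIntegral s E x) + (ballIntegral s E x - g x)) -
      ((V * charFn F x - ballIntegral s F x) + (ballIntegral s F x - g x)) := by ring
  rw [this]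
  exact enorm_sub_le.trans (add_le_add (enorm_add_le _ _) (enorm_add_le _ _))

/-- If the exit volumes of the sets grow linearly down to vanishing scales, then convergence of
local averages implies that the characteristic functions form a Cauchy sequence in `L¹`. -/
theorem eventually_eLpNorm_charFn_sub_lt {d : ℕ} {Ω : Set (Space d)}
    (hΩ : Bornology.IsBounded Ω) {E : ℕ → Set (Space d)} (hE : ∀ n, MeasurableSet (E n))
    (hEΩ : ∀ n, E n ⊆ Ω) {ε : ℕ → ℝ} (hε : Tendsto ε atTop (𝓝 0)) {M : ℝ≥0}
    (hM : ∀ n h, exitVolume (E n) h ≤ M * ENNReal.ofReal (‖h‖ + ε n))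
    (hconv : ∀ B : Set (Space d), MeasurableSet B → volume B ≠ ∞ →
      ∃ l, Tendsto (fun n => volume.real (E n ∩ B)) atTop (𝓝 l)) {η : ℝ≥0∞} (hη : 0 < η) :
    ∃ N, ∀ m ≥ N, ∀ n ≥ N, eLpNorm (charFn (E m) - charFn (E n)) 1 volume < η := by
  have hη2 : 0 < η / 2 := ENNReal.half_pos hη.ne'
  have hfin : ∀ n, volume (E n) ≠ ∞ := fun n =>
    ne_top_of_le_ne_top hΩ.measure_lt_top.ne (measure_mono (hEΩ n))
  -- After division by the volume of the ball, averaging at scale `s` costs `2 M s` per set in the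
  -- limit; two sets are compared, hence `η / 2`.
  obtain ⟨s, hs, hsη⟩ : ∃ s : ℝ, 0 < s ∧ 2 * (M * ENNReal.ofReal s) < η / 2 := by
    have hcont : Tendsto (fun s : ℝ => 2 * (M * ENNReal.ofReal s)) (𝓝[>] 0)
        (𝓝 (2 * (M * ENNReal.ofReal 0))) := by
      refine ENNReal.Tendsto.const_mul (ENNReal.Tendsto.const_mul ?_ (Or.inr ENNReal.coe_ne_top))
        (Or.inr ENNReal.ofNat_ne_top)
      exact ENNReal.tendsto_ofReal (tendsto_id.mono_left nhdsWithin_le_nhds)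
    rw [ENNReal.ofReal_zero, mul_zero, mul_zero] at hcont
    obtain ⟨s, h1, h2⟩ := ((hcont.eventually (gt_mem_nhds hη2)).and self_mem_nhdsWithin).exists
    exact ⟨s, h2, h1⟩
  obtain ⟨g, hg, hlim⟩ := exists_tendsto_lintegral_ballIntegral_sub hΩ hE hEΩ s hconv
  set V := volume (Metric.ball (0 : Space d) s) with hVdef
  have hV0 : V ≠ 0 := (Metric.measure_ball_pos volume _ hs).ne'
  have hVtop : V ≠ ∞ := measure_ball_lt_top.ne
  set b : ℕ → ℝ≥0∞ := fun n => 2 * (M * ENNReal.ofReal (s + ε n)) * V +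
    ∫⁻ x, ‖ballIntegral s (E n) x - g x‖ₑ
  have hb : Tendsto b atTop (𝓝 (2 * (M * ENNReal.ofReal (s + 0)) * V + 0)) := by
    refine Tendsto.add ?_ hlim
    refine ENNReal.Tendsto.mul_const (ENNReal.Tendsto.const_mul (ENNReal.Tendsto.const_mul ?_
      (Or.inr ENNReal.coe_ne_top)) (Or.inr ENNReal.ofNat_ne_top)) (Or.inr hVtop)
    exact ENNReal.tendsto_ofReal (tendsto_const_nhds.add hε)
  have hlt : 2 * (M * ENNReal.ofReal (s + 0)) * V + 0 < η / 2 * V := by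
    rw [add_zero, add_zero]
    exact ENNReal.mul_lt_mul_left hV0 hVtop hsη
  obtain ⟨N, hN⟩ := eventually_atTop.1 (hb.eventually (gt_mem_nhds hlt))
  have hbound : ∀ n, (∫⁻ x, ‖volume.real (Metric.ball (0 : Space d) s) * charFn (E n) x -
      ballIntegral s (E n) x‖ₑ) + ∫⁻ x, ‖ballIntegral s (E n) x - g x‖ₑ ≤ b n := by
    intro n
    refine add_le_add ?_ le_rfl
    refine lintegral_enorm_ballIntegral_sub_le (hE n) (hfin n) fun h hh => (hM n h).trans ?_
    gcongr
  refine ⟨N, fun m hm n hn => ?_⟩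
  have h1 : V * eLpNorm (charFn (E m) - charFn (E n)) 1 volume < V * η := by
    calc V * eLpNorm (charFn (E m) - charFn (E n)) 1 volume
        ≤ b m + b n := (mul_eLpNorm_charFn_sub_le (hE m) (hE n) hg).trans
          (add_le_add (hbound m) (hbound n))
      _ < η / 2 * V + η / 2 * V := ENNReal.add_lt_add (hN m hm) (hN n hn)
      _ = V * η := by rw [← add_mul, ENNReal.add_halves, mul_comm]
  exact lt_of_mul_lt_mul_left' h1

theorem exists_subseq_tendsto_eLpNorm {d : ℕ} {Ω : Set (Space d)}
    (hΩ : Bornology.IsBounded Ω) (hΩm : MeasurableSet Ω) {E : ℕ → Set (Space d)}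
    (hE : ∀ n, MeasurableSet (E n)) (hEΩ : ∀ n, E n ⊆ Ω) {ε : ℕ → ℝ}
    (hε : Tendsto ε atTop (𝓝 0)) {M : ℝ≥0}
    (hM : ∀ n h, exitVolume (E n) h ≤ M * ENNReal.ofReal (‖h‖ + ε n)) :
    ∃ k : ℕ → ℕ, StrictMono k ∧ ∃ E₀ : Set (Space d), MeasurableSet E₀ ∧ E₀ ⊆ Ω ∧
      Tendsto (fun j => eLpNorm (charFn (E (k j)) - charFn E₀) 1 volume) atTop (𝓝 0) := by
  have hfin : ∀ n, volume (E n) ≠ ∞ := fun n =>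
    ne_top_of_le_ne_top hΩ.measure_lt_top.ne (measure_mono (hEΩ n))
  obtain ⟨k, hk, hconv⟩ :=
    exists_subseq_forall_tendsto_volume_inter hΩ.measure_lt_top.ne hE hEΩ
  set f : ℕ → Lp ℝ 1 (volume : Measure (Space d)) := fun j =>
    (memLp_charFn (hE (k j)) (hfin (k j))).toLp
  have hcauchy : CauchySeq f := by
    refine EMetric.cauchySeq_iff.2 fun η hη => ?_
    obtain ⟨N, hN⟩ := eventually_eLpNorm_charFn_sub_lt hΩ (fun j => hE (k j))
      (fun j => hEΩ (k j)) (hε.comp hk.tendsto_atTop) (fun j h => hM (k j) h) hconv hη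
    refine ⟨N, fun m hm n hn => ?_⟩
    rw [Lp.edist_toLp_toLp]
    exact hN m hm n hn
  obtain ⟨F, hF⟩ := cauchySeq_tendsto_of_complete hcauchy
  have hFlim : Tendsto (fun j => eLpNorm (charFn (E (k j)) - ⇑F) 1 volume) atTop (𝓝 0) := by
    have h1 := tendsto_iff_edist_tendsto_0.1 hF
    refine h1.congr fun j => ?_
    rw [Lp.edist_def]
    exact eLpNorm_congr_ae ((memLp_charFn (hE (k j)) (hfin (k j))).coeFn_toLp.sub ae_eq_rfl)
  have hFm : Measurable (F : Space d → ℝ) := (Lp.stronglyMeasurable F).measurable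
  -- The `L¹` limit `F` need not be literally an indicator. Thresholding at `1 / 2` costs a factor
  -- 2: wherever the new set disagrees with `E (k j)` inside `Ω`, `F` is at least `1 / 2` away from
  -- `χ`.
  refine ⟨k, hk, {x | 1 / 2 < F x} ∩ Ω,
    (measurableSet_lt measurable_const hFm).inter hΩm, inter_subset_right, ?_⟩
  have hle : ∀ j, eLpNorm (charFn (E (k j)) - charFn ({x | 1 / 2 < F x} ∩ Ω)) 1 volume ≤
      2 * eLpNorm (charFn (E (k j)) - ⇑F) 1 volume := by
    intro j
    have := eLpNorm_le_mul_eLpNorm_of_ae_le_mul (μ := (volume : Measure (Space d)))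
      (f := charFn (E (k j)) - charFn ({x | 1 / 2 < F x} ∩ Ω)) (g := charFn (E (k j)) - ⇑F)
      (c := 2) (Eventually.of_forall fun x => by
        simp only [Pi.sub_apply, Real.norm_eq_abs]
        by_cases hx : x ∈ Ω
        · by_cases hxE : x ∈ E (k j) <;> by_cases hxF : 1 / 2 < F x
          · have hx2 : x ∈ {x | 1 / 2 < F x} ∩ Ω := ⟨hxF, hx⟩
            simp only [charFn, indicator_of_mem hxE, indicator_of_mem hx2, sub_self, abs_zero]
            positivity
          · have hx2 : x ∉ {x | 1 / 2 < F x} ∩ Ω := fun h => hxF h.1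
            simp only [charFn, indicator_of_mem hxE, indicator_of_notMem hx2, sub_zero, abs_one]
            linarith [le_abs_self (1 - F x)]
          · have hx2 : x ∈ {x | 1 / 2 < F x} ∩ Ω := ⟨hxF, hx⟩
            simp only [charFn, indicator_of_notMem hxE, indicator_of_mem hx2, zero_sub, abs_neg,
              abs_one]
            linarith [le_abs_self (F x)]
          · have hx2 : x ∉ {x | 1 / 2 < F x} ∩ Ω := fun h => hxF h.1
            simp only [charFn, indicator_of_notMem hxE, indicator_of_notMem hx2, sub_self, abs_zero]
            positivity
        · have hx2 : x ∉ {x | 1 / 2 < F x} ∩ Ω := fun h => hx h.2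
          have hx1 : x ∉ E (k j) := fun h => hx (hEΩ _ h)
          simp only [charFn, indicator_of_notMem hx1, indicator_of_notMem hx2, sub_self, abs_zero]
          positivity) 1
    simpa using this
  have h2 : Tendsto (fun j => 2 * eLpNorm (charFn (E (k j)) - ⇑F) 1 volume) atTop (𝓝 (2 * 0)) :=
    ENNReal.Tendsto.const_mul hFlim (Or.inr ENNReal.ofNat_ne_top)
  rw [mul_zero] at h2
  exact tendsto_of_tendsto_of_tendsto_of_le_of_le tendsto_const_nhds h2 (fun _ => zero_le) hle

/-! ### Passage to the limit and finite perimeter -/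

/-- A point that leaves `F` also leaves `E`, unless it or its translate lies in the symmetric
difference. -/
theorem exitVolume_le_add_eLpNorm {d : ℕ} {E F : Set (Space d)} (hE : MeasurableSet E)
    (hF : MeasurableSet F) (h : Space d) :
    exitVolume F h ≤ exitVolume E h + 2 * eLpNorm (charFn E - charFn F) 1 volume := by
  rw [eLpNorm_charFn_sub hE hF]
  calc exitVolume F h
      ≤ volume ({x | x ∈ E ∧ x + h ∉ E} ∪ (symmDiff E F ∪ {x | x + h ∈ symmDiff E F})) := by
        refine measure_mono ?_
        rintro x ⟨hx, hxh⟩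
        by_cases h1 : x ∈ E
        · by_cases h2 : x + h ∈ E
          · exact Or.inr (Or.inr (Or.inl ⟨h2, hxh⟩))
          · exact Or.inl ⟨h1, h2⟩
        · exact Or.inr (Or.inl (Or.inr ⟨hx, h1⟩))
    _ ≤ exitVolume E h + (volume (symmDiff E F) + volume {x | x + h ∈ symmDiff E F}) :=
        (measure_union_le _ _).trans (add_le_add le_rfl (measure_union_le _ _))
    _ = _ := by rw [volume_preimage_add_right, two_mul]

theorem exitVolume_le_of_tendsto {d : ℕ} {E : ℕ → Set (Space d)} {E₀ : Set (Space d)}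
    (hE : ∀ n, MeasurableSet (E n)) (hE₀ : MeasurableSet E₀) {ε : ℕ → ℝ}
    (hε : Tendsto ε atTop (𝓝 0)) {M : ℝ≥0}
    (hM : ∀ n h, exitVolume (E n) h ≤ M * ENNReal.ofReal (‖h‖ + ε n))
    (hlim : Tendsto (fun n => eLpNorm (charFn (E n) - charFn E₀) 1 volume) atTop (𝓝 0))
    (h : Space d) : exitVolume E₀ h ≤ M * ‖h‖ₑ := by
  have h1 : Tendsto (fun n => M * ENNReal.ofReal (‖h‖ + ε n) +
      2 * eLpNorm (charFn (E n) - charFn E₀) 1 volume) atTop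
      (𝓝 (M * ENNReal.ofReal (‖h‖ + 0) + 2 * 0)) := by
    refine Tendsto.add (ENNReal.Tendsto.const_mul ?_ (Or.inr ENNReal.coe_ne_top))
      (ENNReal.Tendsto.const_mul hlim (Or.inr ENNReal.ofNat_ne_top))
    exact ENNReal.tendsto_ofReal (tendsto_const_nhds.add hε)
  rw [add_zero, mul_zero, add_zero, ofReal_norm] at h1
  exact ge_of_tendsto' h1 fun n =>
    (exitVolume_le_add_eLpNorm (hE n) hE₀ h).trans (add_le_add (hM n h) le_rfl)

/-- Discrete integration by parts: translation invariance moves the difference from `ψ` onto `χ_E`.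
-/
theorem integral_translate_sub_mul_charFn_le {d : ℕ} {E : Set (Space d)} (hE : MeasurableSet E)
    (hfin : volume E ≠ ∞) {ψ : Space d → ℝ} (hψ : Continuous ψ) (hψ1 : ∀ x, |ψ x| ≤ 1)
    {M : ℝ≥0} (h : Space d) (hM : exitVolume E h ≤ M * ‖h‖ₑ) :
    ∫ x, (ψ (x + h) - ψ x) * charFn E x ≤ 2 * M * ‖h‖ := by
  have hEint : Integrable (charFn E) volume := memLp_one_iff_integrable.1 (memLp_charFn hE hfin)
  have hint : Integrable (fun x => ψ x * charFn E x) volume :=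
    hEint.bdd_mul hψ.aestronglyMeasurable (Eventually.of_forall hψ1)
  have hint1 : Integrable (fun x => ψ (x + h) * charFn E x) volume :=
    hEint.bdd_mul (hψ.comp (continuous_add_const h)).aestronglyMeasurable
      (Eventually.of_forall fun x => hψ1 _)
  have hint2 : Integrable (fun x => ψ (x + h) * charFn E (x + h)) volume :=
    hint.comp_add_right h
  have heq : ∫ x, (ψ (x + h) - ψ x) * charFn E x =
      ∫ x, ψ (x + h) * (charFn E x - charFn E (x + h)) := by
    have h1 : ∫ x, ψ (x + h) * charFn E (x + h) = ∫ x, ψ x * charFn E x :=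
      integral_add_right_eq_self (fun x => ψ x * charFn E x) h
    simp_rw [sub_mul, mul_sub]
    rw [integral_sub hint1 hint, integral_sub hint1 hint2, h1]
  have hle : ‖∫ x, ψ (x + h) * (charFn E x - charFn E (x + h))‖ₑ ≤ 2 * (M * ‖h‖ₑ) := by
    refine (enorm_integral_le_lintegral_enorm _).trans ?_
    calc ∫⁻ x, ‖ψ (x + h) * (charFn E x - charFn E (x + h))‖ₑ
        ≤ ∫⁻ x, ‖charFn E x - charFn E (x + h)‖ₑ := by
          refine lintegral_mono fun x => ?_
          rw [enorm_mul]
          refine mul_le_of_le_one_left zero_le ?_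
          rw [← ofReal_norm, ENNReal.ofReal_le_one]
          exact hψ1 _
      _ ≤ 2 * exitVolume E h := lintegral_enorm_charFn_sub_translate hE hfin h
      _ ≤ _ := by gcongr
  rw [heq]
  refine (le_abs_self _).trans ?_
  rw [← Real.norm_eq_abs, ← toReal_enorm]
  refine (ENNReal.toReal_mono (by finiteness) hle).trans (le_of_eq ?_)
  simp [mul_assoc]

/-- Divide the discrete estimate by `t` and let `t → 0⁺`; for Lipschitz `ψ` the integrated
difference quotients converge. -/
theorem integral_lineDeriv_mul_charFn_le {d : ℕ} {E : Set (Space d)} (hE : MeasurableSet E)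
    (hfin : volume E ≠ ∞) {M : ℝ≥0} (hM : ∀ h, exitVolume E h ≤ M * ‖h‖ₑ) {ψ : Space d → ℝ}
    {L : ℝ≥0} (hψ : LipschitzWith L ψ) (hψ1 : ∀ x, |ψ x| ≤ 1) {v : Space d} (hv : ‖v‖ = 1) :
    ∫ x, lineDeriv ℝ ψ x v * charFn E x ≤ 2 * M := by
  have hEint : Integrable (charFn E) volume := memLp_one_iff_integrable.1 (memLp_charFn hE hfin)
  have hlim := hψ.integral_inv_smul_sub_mul_tendsto_integral_lineDeriv_mul hEint v
  refine le_of_tendsto hlim ?_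
  filter_upwards [self_mem_nhdsWithin] with t ht
  have ht : 0 < t := ht
  simp_rw [smul_eq_mul, mul_assoc]
  rw [integral_const_mul, inv_mul_le_iff₀ ht]
  have := integral_translate_sub_mul_charFn_le hE hfin hψ.continuous hψ1 (t • v) (hM _)
  rw [norm_smul, hv, mul_one, Real.norm_of_nonneg ht.le] at this
  linarith

/-- A set whose exit volume is at most `M ‖h‖` has finite perimeter. -/
theorem hasFinitePerimeter_of_exitVolume_le {d : ℕ} {E Ω : Set (Space d)} (hE : MeasurableSet E)
    (hEΩ : E ⊆ Ω) (hfin : volume E ≠ ∞) {M : ℝ≥0} (hM : ∀ h, exitVolume E h ≤ M * ‖h‖ₑ) :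
    HasFinitePerimeter E Ω := by
  have hEint : Integrable (charFn E) volume := memLp_one_iff_integrable.1 (memLp_charFn hE hfin)
  refine ⟨hE.nullMeasurableSet, hEint.integrableOn, ?_⟩
  -- One directional bound `2 M` for each of the `d` terms of the divergence.
  refine lt_of_le_of_lt (b := ENNReal.ofReal (d * (2 * M))) ?_ ENNReal.ofReal_lt_top
  refine iSup₂_le fun φ hφ => ENNReal.ofReal_le_ofReal ?_
  obtain ⟨hφ1, hφc, -, hφb⟩ := hφ
  obtain ⟨L, hL⟩ := hφ1.lipschitzWith_of_hasCompactSupport hφc one_ne_zero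
  have hcoord : ∀ i : Fin d, LipschitzWith L fun x => φ x i := fun i =>
    LipschitzWith.of_dist_le_mul fun x y => by
      refine le_trans ?_ (hL.dist_le_mul x y)
      rw [dist_eq_norm, dist_eq_norm]
      exact PiLp.norm_apply_le (φ x - φ y) i
  have hcoord1 : ∀ (i : Fin d) x, |φ x i| ≤ 1 := fun i x =>
    (PiLp.norm_apply_le (φ x) i).trans (hφb x)
  have hline : ∀ (i : Fin d) x, lineDeriv ℝ (fun x => φ x i) x (EuclideanSpace.single i 1) =
      (fderiv ℝ φ x (EuclideanSpace.single i 1)) i := by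
    intro i x
    have h1 : HasFDerivAt φ (fderiv ℝ φ x) x := (hφ1.differentiable one_ne_zero x).hasFDerivAt
    have h2 := ((EuclideanSpace.proj i : Space d →L[ℝ] ℝ).hasFDerivAt (x := φ x)).comp x h1
    exact (h2.hasLineDerivAt _).lineDeriv
  have hint : ∀ i : Fin d, Integrable (fun x => lineDeriv ℝ (fun x => φ x i) x
      (EuclideanSpace.single i 1) * charFn E x) volume := by
    intro i
    refine hEint.bdd_mul (c := L * ‖EuclideanSpace.single i (1 : ℝ)‖) ?_
      (Eventually.of_forall fun x => norm_lineDeriv_le_of_lipschitz ℝ (hcoord i))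
    exact (measurable_lineDeriv (hcoord i).continuous).aestronglyMeasurable
  calc ∫ x in Ω, charFn E x * divergence φ x
      = ∫ x, charFn E x * divergence φ x := by
        refine setIntegral_eq_integral_of_forall_compl_eq_zero fun x hx => ?_
        rw [charFn, indicator_of_notMem fun h => hx (hEΩ h), zero_mul]
    _ = ∫ x, ∑ i : Fin d, lineDeriv ℝ (fun x => φ x i) x (EuclideanSpace.single i 1) *
          charFn E x := by
        refine integral_congr_ae (Eventually.of_forall fun x => ?_)
        simp only [divergence, hline, Finset.mul_sum, mul_comm]
    _ = ∑ i : Fin d, ∫ x, lineDeriv ℝ (fun x => φ x i) x (EuclideanSpace.single i 1) *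
          charFn E x := integral_finsetSum _ fun i _ => hint i
    _ ≤ ∑ _i : Fin d, 2 * (M : ℝ) := by
        refine Finset.sum_le_sum fun i _ => ?_
        exact integral_lineDeriv_mul_charFn_le hE hfin hM (hcoord i) (hcoord1 i) (by simp)
    _ = _ := by simp

theorem localEnergy_congr_charFn {d : ℕ} (K : Space d → ℝ) {E F Ω : Set (Space d)}
    (h : E =ᵐ[volume] F) : localEnergy K (charFn E) Ω = localEnergy K (charFn F) Ω := by
  have h' : charFn E =ᵐ[volume.restrict Ω] charFn F :=
    ae_restrict_of_ae (indicator_ae_eq_of_ae_eq_set h)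
  refine lintegral_congr_ae ?_
  filter_upwards [h'] with x hx
  refine lintegral_congr_ae ?_
  filter_upwards [h'] with y hy
  rw [hx, hy]

end NonlocalPerimeter

open NonlocalPerimeter in
theorem mainTheorem6 (d : ℕ) (hd : 1 ≤ d)
    (Ω : Set (NonlocalPerimeter.Space d)) (hΩ_open : IsOpen Ω) (hΩ_conn : IsConnected Ω)
    (hΩ_bdd : Bornology.IsBounded Ω) (hΩ_lip : NonlocalPerimeter.HasLipschitzBoundary Ω)
    (Kbar : ℝ → ℝ) (hK_nonneg : ∀ r, 0 ≤ r → 0 ≤ Kbar r)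
    (hK_meas : AEMeasurable Kbar (volume.restrict (Ici 0)))
    (hK_int : ∫⁻ r in Ici (0 : ℝ), ENNReal.ofReal (Kbar r * r ^ d) < ∞)
    (hK_ne : ¬ NonlocalPerimeter.radialKernel d Kbar =ᵐ[volume] 0)
    (ε : ℕ → ℝ) (hε_pos : ∀ n, 0 < ε n) (hε_lim : Tendsto ε atTop (𝓝 0))
    (E : ℕ → Set (NonlocalPerimeter.Space d))
    (hE_meas : ∀ n, NullMeasurableSet (E n) volume) (hE_sub : ∀ n, E n ⊆ Ω)
    (C : ℝ≥0)
    (hE_bdd : ∀ n, ENNReal.ofReal (1 / ε n) *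
      NonlocalPerimeter.localEnergy
        (NonlocalPerimeter.rescale (NonlocalPerimeter.radialKernel d Kbar) (ε n))
        (NonlocalPerimeter.charFn (E n)) Ω ≤ C) :
    ∃ k : ℕ → ℕ, StrictMono k ∧ ∃ E₀ : Set (NonlocalPerimeter.Space d),
      NonlocalPerimeter.HasFinitePerimeter E₀ Ω ∧
        NonlocalPerimeter.TendstoL1 (fun j => E (k j)) E₀ Ω := by
  obtain ⟨δ, hδ, R, A, hA, hneg, hpos, hR, hK⟩ :=
    exists_set_le_radialKernel hd hK_nonneg hK_meas hK_ne
  obtain ⟨CΩ, hCΩ⟩ := exists_exitVolume_le hΩ_bdd hΩ_lip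
  obtain ⟨M, hM⟩ := exists_forall_exitVolume_le hΩ_open.measurableSet hCΩ hA hneg hpos hR hδ hK C
  -- Measurable representatives taken inside `E n` remain subsets of `Ω` and have the same energy.
  choose F hFE hF hFeq using fun n => (hE_meas n).exists_measurable_subset_ae_eq
  have hFΩ : ∀ n, F n ⊆ Ω := fun n => (hFE n).trans (hE_sub n)
  have hFM : ∀ n h, exitVolume (F n) h ≤ M * ENNReal.ofReal (‖h‖ + ε n) := fun n =>
    hM (ε n) (F n) (hε_pos n) (hF n) (hFΩ n)
      (by rw [localEnergy_congr_charFn _ (hFeq n)]; exact hE_bdd n)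
  obtain ⟨k, hk, E₀, hE₀, hE₀Ω, hlim⟩ :=
    exists_subseq_tendsto_eLpNorm hΩ_bdd hΩ_open.measurableSet hF hFΩ hε_lim hFM
  refine ⟨k, hk, E₀, ?_, ?_⟩
  · exact hasFinitePerimeter_of_exitVolume_le hE₀ hE₀Ω
      (ne_top_of_le_ne_top hΩ_bdd.measure_lt_top.ne (measure_mono hE₀Ω))
      (exitVolume_le_of_tendsto (fun j => hF (k j)) hE₀ (hε_lim.comp hk.tendsto_atTop)
        (fun j => hFM (k j)) hlim)
  · refine tendsto_of_tendsto_of_tendsto_of_le_of_le tendsto_const_nhds hlim (fun _ => zero_le)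
      fun j => ?_
    have : charFn (E (k j)) =ᵐ[volume] charFn (F (k j)) :=
      indicator_ae_eq_of_ae_eq_set (hFeq (k j)).symm
    calc _ ≤ eLpNorm (charFn (E (k j)) - charFn E₀) 1 volume :=
          eLpNorm_mono_measure _ Measure.restrict_le_self
      _ = _ := eLpNorm_congr_ae (this.sub ae_eq_rfl)
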